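/- Let $\mathcal X$ be a locally compact second countable space (for example a compact subset of $\mathbb R^d$), let $\mathcal C=C(\mathcal X,[0,\infty))$ with its Borel $\sigma$-algebra (compact-open topology), and let $\nu$ be an s-finite measure on $\mathcal C$ (for example a locally finite one) with $\int_{\mathcal C}\psi(y)\,\nu(\mathrm d\psi)=1$ for all $y\in\mathcal X$. Let $\{(\zeta_i,\psi_i),\,i\ge1\}$ be a Poisson point process on $(0,\infty)\times\mathcal C$ with intensity $\zeta^{-2}\mathrm d\zeta\,\nu(\mathrm d\psi)$ and $Z(y)=\max_{i\ge1}\zeta_i\psi_i(y)$. For $y\in\mathcal X$ let $P_y(A)=\int_{\mathcal C}1_{\{f/f(y)\in A\}}\,f(y)\,\nu(\mathrm df)$ for Borel $A\subset\mathcal C$. Fix $N\ge1$ and locations $x=(x_1,\dots,x_N)\in\mathcal X^N$, and write $f(x)=(f(x_1),\dots,f(x_N))$, $E=[0,\infty)^N$, $\|z\|=z_1+\dots+z_N$, $S_{N-1}=\{z\in E:\|z\|=1\}$ and $U(z)=(\|z\|,z/\|z\|)$ for $z\in E\setminus\{0\}$. Let $\mu_x$ be the image of $\zeta^{-2}\mathrm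 d\zeta\,\nu(\mathrm d\psi)$ under $(\zeta,\psi)\mapsto\zeta\psi(x)$. There is exactly one probability measure $H$ on $S_{N-1}$, the spectral measure of $Z(x)$, such that $$\mu_x(F)=N\int_{U(F)}r^{-2}\,\mathrm dr\,H(\mathrm ds)\qquad\text{for all Borel }F\subset E\setminus\{0\}.$$ Let $T_i$, $i\ge1$, be uniformly distributed on $\{1,\dots,N\}$, let $Y_i^{(k)}$ be random elements of $\mathcal C$ with distribution $P_{x_k}$, $k=1,\dots,N$, $i\ge1$, and suppose that $T_i$ is independent of $(Y_i^{(1)},\dots,Y_i^{(N)})$ for each $i$ and that the families $(T_i,Y_i^{(1)},\dots,Y_i^{(N)})$, $i\ge1$, are independent of each other. Then the random vectors $$Q_i=\frac{Y_i^{(T_i)}(x)}{\|Y_i^{(T_i)}(x)\|},\qquad i\ge1,$$ are almost surely $S_{N-1}$-valued, independent, and distributed according to $H$. Consequently, if $\{R_i,\,i\ge1\}$ is a Poisson point process on $(0,\infty)$ with intensity $Nr^{-2}\mathrm dr$, independent of all the $T_i$ and $Y_i^{(k)}$, then $$Z(x)\;\stackrel{d}{=}\;\max_{i\ge1}R_i\,\frac{Y_i^{(T_i)}(x)}{\|Y_i^{(T_i)}(x)\|}$$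 (componentwise maximum, equality in distribution of random vectors), where on both sides all the componentwise maxima are almost surely attained. -/

import Mathlib

open MeasureTheory ProbabilityTheory
open scoped NNReal ENNReal

noncomputable section

namespace MaxStable

/-- `{p i : i ∈ ℕ}` is a Poisson point process on `S` with intensity measure `Λ`: the numbers of
points in disjoint measurable sets are independent, and the number of points in `B` is Poisson
distributed with mean `Λ B` (almost surely infinite when `Λ B = ∞`). -/
structure IsPoissonProcess {Ω S : Type*} [MeasurableSpace Ω] [MeasurableSpace S]
    (p : ℕ → Ω → S) (Λ : Measure S) (P : Measure Ω) : Prop where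
  measurable : ∀ i, Measurable (p i)
  hasLaw_count : ∀ B : Set S, MeasurableSet B → Λ B ≠ ∞ →
    HasLaw (fun ω => {i | p i ω ∈ B}.encard)
      ((poissonMeasure (Λ B).toNNReal).map (Nat.cast : ℕ → ℕ∞)) P
  count_eq_top : ∀ B : Set S, MeasurableSet B → Λ B = ∞ →
    ∀ᵐ ω ∂P, {i | p i ω ∈ B}.encard = ⊤
  indep_count : ∀ (n : ℕ) (B : Fin n → Set S), (∀ k, MeasurableSet (B k)) →
    Pairwise (fun k l => Disjoint (B k) (B l)) →
    iIndepFun (fun k ω => {i | p i ω ∈ B k}.encard) P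

/-- The measure `c r⁻² dr` on `(0, ∞)`, as a measure on `[0, ∞)` (the point `0` has mass zero). -/
def radialMeasure (c : ℝ≥0) : Measure ℝ≥0 :=
  ((volume.restrict (Set.Ioi (0 : ℝ))).withDensity fun r => ENNReal.ofReal (c * (r ^ 2)⁻¹)).map
    Real.toNNReal

/-- The `L₁`-norm of a vector in `[0, ∞)ᴺ`. -/
def l1Norm {N : ℕ} (z : Fin N → ℝ≥0) : ℝ≥0 := ∑ j, z j

/-- Polar coordinates `z ↦ (‖z‖, z / ‖z‖)`, meaningful for `z ≠ 0`. -/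
def polar {N : ℕ} (z : Fin N → ℝ≥0) : ℝ≥0 × (Fin N → ℝ≥0) :=
  (l1Norm z, (l1Norm z)⁻¹ • z)

section Functions

variable {X : Type*} [TopologicalSpace X]

/-- The restriction `f(x) = (f(x₁), …, f(x_N))` of `f` to the locations `x`. -/
def restr {N : ℕ} (x : Fin N → X) (f : C(X, ℝ≥0)) : Fin N → ℝ≥0 := fun j => f (x j)

/-- The intensity measure of `{ζ_i ψ_i(x)}`: the image of `ζ⁻² dζ × ν(dψ)` under
`(ζ, ψ) ↦ ζ ψ(x)`. -/
def exponentMeasure [MeasurableSpace C(X, ℝ≥0)] {N : ℕ} (ν : Measure C(X, ℝ≥0))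
    (x : Fin N → X) : Measure (Fin N → ℝ≥0) :=
  ((radialMeasure 1).prod ν).map fun p => p.1 • restr x p.2

/-- The law `P_y(A) = ∫ 1{f / f(y) ∈ A} f(y) ν(df)`. -/
def extremalLaw [MeasurableSpace C(X, ℝ≥0)] (ν : Measure C(X, ℝ≥0)) (y : X) :
    Measure C(X, ℝ≥0) :=
  (ν.withDensity fun f => (f y : ℝ≥0∞)).map fun f => (f y)⁻¹ • f

/-- The process `Z(y) = max_i ζ_i ψ_i(y)`, `y ∈ X`, written with a supremum. -/
def maxProcess {Ω : Type*} (ζ : ℕ → Ω → ℝ≥0) (ψ : ℕ → Ω → C(X, ℝ≥0)) (y : X) (ω : Ω) : ℝ≥0 :=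
  ⨆ i, ζ i ω * ψ i ω y

end Functions

/-- `H` is a spectral measure of the exponent measure `μ` on `[0, ∞)ᴺ`: a probability measure
carried by the `L₁`-simplex such that, in polar coordinates, `μ` restricted to the complement of
the origin is `N r⁻² dr × H(ds)`. -/
structure IsSpectralMeasure {N : ℕ} (μ H : Measure (Fin N → ℝ≥0)) : Prop where
  isProbabilityMeasure : IsProbabilityMeasure H
  simplex : H (stdSimplex ℝ≥0 (Fin N))ᶜ = 0
  polar_eq : ∀ F : Set (Fin N → ℝ≥0), MeasurableSet F → 0 ∉ F →
    μ F = ((radialMeasure N).prod H) (polar '' F)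

end MaxStable

end

namespace MaxStable

/-! ### The radial measure -/

/-! The measure `r⁻² dr` is homogeneous: stretching the radius by `a` multiplies it by `a`. In polar
coordinates the norm `‖f(x)‖` therefore leaves the radius and becomes a density, so `H` must be the
law of the direction of `f(x)` under `N⁻¹ ‖f(x)‖ ν(df)`; its mass is 1 because each coordinate
integrates to 1 (`isSpectralMeasure_spectralMeasure`). Uniqueness follows by evaluating on `{‖z‖ >
1}`.

Directions do not see the normalisation `f / f(x_k)`, so under `P_{x_k}` the direction has weight
`f(x_k) ν(df)`. Averaging over a uniform `k` gives `N⁻¹ ‖f(x)‖ ν(df)`, which is `H` again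
(`map_select_direction`).

For the representation, both distribution functions are computed at `z` with positive coordinates.
On the Poisson side it is a void probability (`measure_maxProcess_le`). On the other side,
conditioning on the radii gives the product of `H {q | R_i • q ≤ z}`, whose mean is supplied by the
generating functional `lintegral_tprod` (`measure_iSup_radial_le`). The exponents agree by the polar
form of `μ_x`. Maxima are attained since almost surely only finitely many points exceed each
positive level. -/

instance sFinite_radialMeasure (c : ℝ≥0) : SFinite (radialMeasure c) := by
  unfold radialMeasure; infer_instance

lemma lintegral_radialMeasure (c : ℝ≥0) {f : ℝ≥0 → ℝ≥0∞} (hf : Measurable f) :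
    ∫⁻ r, f r ∂radialMeasure c =
      ∫⁻ r in Set.Ioi (0 : ℝ), ENNReal.ofReal (c * (r ^ 2)⁻¹) * f r.toNNReal := by
  rw [radialMeasure, lintegral_map hf measurable_real_toNNReal,
    lintegral_withDensity_eq_lintegral_mul _ (by fun_prop) (by fun_prop)]
  rfl

lemma radialMeasure_eq_smul (c : ℝ≥0) : radialMeasure c = (c : ℝ≥0∞) • radialMeasure 1 := by
  refine Measure.ext_of_lintegral _ fun f hf => ?_
  rw [lintegral_smul_measure, lintegral_radialMeasure c hf, lintegral_radialMeasure 1 hf,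
    smul_eq_mul, ← lintegral_const_mul _ (by fun_prop)]
  refine lintegral_congr fun r => ?_
  change ENNReal.ofReal (c * (r ^ 2)⁻¹) * _ = c * (ENNReal.ofReal (1 * (r ^ 2)⁻¹) * _)
  rw [ENNReal.ofReal_mul c.coe_nonneg, one_mul, ENNReal.ofReal_coe_nnreal, mul_assoc]

/-- Substitution `u = a r` in `r⁻² dr`; this is the homogeneity on which the polar decomposition
rests. -/
lemma lintegral_radialMeasure_comp_mul {a : ℝ≥0} (ha : a ≠ 0) {f : ℝ≥0 → ℝ≥0∞}
    (hf : Measurable f) :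
    ∫⁻ r, f (a * r) ∂radialMeasure 1 = a * ∫⁻ r, f r ∂radialMeasure 1 := by
  have ha' : (0 : ℝ) < a := by positivity
  rw [lintegral_radialMeasure 1 hf, lintegral_radialMeasure 1 (by fun_prop),
    ← lintegral_indicator measurableSet_Ioi, ← lintegral_indicator measurableSet_Ioi]
  -- Extension by zero to all of `ℝ` makes the scaling rule for Lebesgue measure applicable.
  set g : ℝ → ℝ≥0∞ := (Set.Ioi (0 : ℝ)).indicator fun r =>
    ENNReal.ofReal ((1 : ℝ≥0) * (r ^ 2)⁻¹) * f r.toNNReal with hg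
  have hgm : Measurable g := by
    rw [hg]; exact Measurable.indicator (by fun_prop) measurableSet_Ioi
  have hscale : ∫⁻ r, g r = ENNReal.ofReal |(a : ℝ)| * ∫⁻ r, g (a * r) := by
    conv_lhs => rw [← Real.smul_map_volume_mul_left ha'.ne']
    rw [lintegral_smul_measure, lintegral_map hgm (by fun_prop), smul_eq_mul]
  rw [hscale, abs_of_pos ha', ENNReal.ofReal_coe_nnreal, ← mul_assoc,
    ← lintegral_const_mul _ (by fun_prop)]
  refine lintegral_congr fun r => ?_
  by_cases hr : 0 < r
  · rw [hg, Set.indicator_of_mem (Set.mem_Ioi.2 hr),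
      Set.indicator_of_mem (Set.mem_Ioi.2 (mul_pos ha' hr)), Real.toNNReal_mul ha'.le,
      Real.toNNReal_coe, ← mul_assoc]
    congr 1
    rw [← ENNReal.ofReal_coe_nnreal, ← ENNReal.ofReal_mul ha'.le,
      ← ENNReal.ofReal_mul (by positivity)]
    congr 1
    field_simp
  · have : ¬ 0 < (a : ℝ) * r := by
      simpa [mul_pos_iff_of_pos_left ha'] using hr
    rw [hg, Set.indicator_of_notMem (by simpa using hr),
      Set.indicator_of_notMem (by simpa using this), mul_zero]

lemma radialMeasure_one_Ioi {t : ℝ≥0} (ht : t ≠ 0) :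
    radialMeasure 1 (Set.Ioi t) = (t : ℝ≥0∞)⁻¹ := by
  have ht' : (0 : ℝ) < t := by positivity
  rw [← lintegral_indicator_one measurableSet_Ioi,
    lintegral_radialMeasure 1 (measurable_one.indicator measurableSet_Ioi),
    ← lintegral_indicator measurableSet_Ioi]
  have : ∀ r : ℝ, (Set.Ioi (0 : ℝ)).indicator (fun r => ENNReal.ofReal ((1 : ℝ≥0) * (r ^ 2)⁻¹) *
      (Set.Ioi t).indicator (1 : ℝ≥0 → ℝ≥0∞) r.toNNReal) r =
      (Set.Ioi (t : ℝ)).indicator (fun r => ENNReal.ofReal (r ^ (-2 : ℝ))) r := by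
    intro r
    by_cases hr : (t : ℝ) < r
    · have h0 : 0 < r := ht'.trans hr
      rw [Set.indicator_of_mem (Set.mem_Ioi.2 hr), Set.indicator_of_mem (Set.mem_Ioi.2 h0),
        Set.indicator_of_mem (by simpa [Real.lt_toNNReal_iff_coe_lt] using hr)]
      simp [Real.rpow_neg h0.le]
    · rw [Set.indicator_of_notMem (s := Set.Ioi (t : ℝ)) (by simpa using hr)]
      by_cases h0 : 0 < r
      · rw [Set.indicator_of_mem (Set.mem_Ioi.2 h0), Set.indicator_of_notMem, mul_zero]
        simpa [Real.lt_toNNReal_iff_coe_lt] using hr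
      · rw [Set.indicator_of_notMem (by simpa using h0)]
  rw [lintegral_congr this, lintegral_indicator measurableSet_Ioi,
    ← ofReal_integral_eq_lintegral_ofReal
      (integrableOn_Ioi_rpow_of_lt (by norm_num) ht')
      ((ae_restrict_mem measurableSet_Ioi).mono fun r hr =>
        Real.rpow_nonneg (ht'.le.trans (Set.mem_Ioi.1 hr).le) _),
    integral_Ioi_rpow_of_lt (by norm_num) ht']
  norm_num
  rw [Real.rpow_neg_one, ENNReal.ofReal_inv_of_pos ht', ENNReal.ofReal_coe_nnreal]

lemma radialMeasure_Ioi (c : ℝ≥0) {t : ℝ≥0} (ht : t ≠ 0) :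
    radialMeasure c (Set.Ioi t) = c * (t : ℝ≥0∞)⁻¹ := by
  rw [radialMeasure_eq_smul, Measure.smul_apply, radialMeasure_one_Ioi ht, smul_eq_mul]

/-! ### Directions -/

section Directions

variable {N : ℕ}

/-- The direction `z / ‖z‖`. -/
noncomputable def direction (z : Fin N → ℝ≥0) : Fin N → ℝ≥0 := (l1Norm z)⁻¹ • z

@[fun_prop]
lemma measurable_l1Norm : Measurable (l1Norm (N := N)) := by
  unfold l1Norm; fun_prop

@[fun_prop]
lemma measurable_direction : Measurable (direction (N := N)) := by
  unfold direction
  exact measurable_l1Norm.inv.smul measurable_id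

lemma l1Norm_smul (r : ℝ≥0) (z : Fin N → ℝ≥0) : l1Norm (r • z) = r * l1Norm z := by
  simp [l1Norm, Finset.mul_sum]

lemma l1Norm_eq_zero {z : Fin N → ℝ≥0} : l1Norm z = 0 ↔ z = 0 := by
  simp [l1Norm, funext_iff]

lemma mem_stdSimplex_iff {z : Fin N → ℝ≥0} : z ∈ stdSimplex ℝ≥0 (Fin N) ↔ l1Norm z = 1 := by
  simp [stdSimplex, l1Norm]

lemma le_one_of_mem_stdSimplex {z : Fin N → ℝ≥0} (hz : z ∈ stdSimplex ℝ≥0 (Fin N)) (j : Fin N) :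
    z j ≤ 1 := by
  rw [mem_stdSimplex_iff] at hz
  exact hz ▸ Finset.single_le_sum (f := z) (fun _ _ => zero_le) (Finset.mem_univ j)

lemma measurableSet_stdSimplex : MeasurableSet (stdSimplex ℝ≥0 (Fin N)) := by
  have : stdSimplex ℝ≥0 (Fin N) = l1Norm ⁻¹' {1} := by
    ext z; exact mem_stdSimplex_iff
  rw [this]
  exact measurable_l1Norm (measurableSet_singleton 1)

lemma direction_smul {r : ℝ≥0} (hr : r ≠ 0) (z : Fin N → ℝ≥0) :
    direction (r • z) = direction z := by
  rw [direction, l1Norm_smul, direction, smul_smul, mul_inv, mul_right_comm,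
    inv_mul_cancel₀ hr, one_mul]

lemma l1Norm_smul_direction (z : Fin N → ℝ≥0) : l1Norm z • direction z = z := by
  by_cases hz : l1Norm z = 0
  · rw [hz, l1Norm_eq_zero.1 hz, zero_smul]
  · rw [direction, smul_inv_smul₀ hz]

lemma direction_mem_stdSimplex {z : Fin N → ℝ≥0} (hz : z ≠ 0) :
    direction z ∈ stdSimplex ℝ≥0 (Fin N) := by
  rw [mem_stdSimplex_iff, direction, l1Norm_smul,
    inv_mul_cancel₀ (mt l1Norm_eq_zero.1 hz)]

lemma direction_of_mem_stdSimplex {z : Fin N → ℝ≥0} (hz : z ∈ stdSimplex ℝ≥0 (Fin N)) :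
    direction z = z := by
  rw [direction, mem_stdSimplex_iff.1 hz, inv_one, one_smul]

/-- Away from the origin, polar coordinates are inverted by `(r, s) ↦ r • s` on the simplex; `0 ∉ F`
excludes `r = 0`. -/
lemma polar_image {F : Set (Fin N → ℝ≥0)} (hF : 0 ∉ F) :
    polar '' F = {p | p.2 ∈ stdSimplex ℝ≥0 (Fin N) ∧ p.1 • p.2 ∈ F} := by
  ext ⟨r, s⟩
  constructor
  · rintro ⟨z, hz, h⟩
    obtain ⟨rfl, rfl⟩ := Prod.mk.inj h
    have h0 : z ≠ 0 := fun h => hF (h ▸ hz)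
    refine ⟨direction_mem_stdSimplex h0, ?_⟩
    simpa [direction] using (l1Norm_smul_direction z).symm ▸ hz
  · rintro ⟨hs, h⟩
    have hr : r ≠ 0 := by
      rintro rfl
      exact hF (by simpa using h)
    refine ⟨r • s, h, Prod.ext ?_ ?_⟩
    · simp [polar, l1Norm_smul, mem_stdSimplex_iff.1 hs]
    · exact (direction_smul hr s).trans (direction_of_mem_stdSimplex hs)

lemma prod_polar_image {ρ : Measure ℝ≥0} {H : Measure (Fin N → ℝ≥0)} [SFinite H] [SFinite ρ]
    (hH : H (stdSimplex ℝ≥0 (Fin N))ᶜ = 0) {F : Set (Fin N → ℝ≥0)} (hF : 0 ∉ F) :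
    (ρ.prod H) (polar '' F) = (ρ.prod H) {p | p.1 • p.2 ∈ F} := by
  rw [polar_image hF]
  refine measure_congr ?_
  have : ∀ᵐ p ∂ρ.prod H, p.2 ∈ stdSimplex ℝ≥0 (Fin N) :=
    Measure.quasiMeasurePreserving_snd.ae (p := fun s => s ∈ stdSimplex ℝ≥0 (Fin N)) hH
  filter_upwards [this] with p hp
  exact propext ⟨fun h => h.2, fun h => ⟨hp, h⟩⟩

/-- The set on the right is the product `(1, ∞) × (A ∩ simplex)` in polar coordinates, and the
radial factor has mass `N`. This determines `H` from `μ`. -/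
lemma IsSpectralMeasure.measure_eq {μ H : Measure (Fin N → ℝ≥0)} (hN : 1 ≤ N)
    (h : IsSpectralMeasure μ H) {A : Set (Fin N → ℝ≥0)} (hA : MeasurableSet A) :
    H A = (N : ℝ≥0∞)⁻¹ * μ {z | 1 < l1Norm z ∧ direction z ∈ A} := by
  have := h.isProbabilityMeasure
  have h0 : (0 : Fin N → ℝ≥0) ∉ {z | 1 < l1Norm z ∧ direction z ∈ A} := by
    simp [l1Norm]
  have hm : MeasurableSet {z : Fin N → ℝ≥0 | 1 < l1Norm z ∧ direction z ∈ A} :=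
    (measurableSet_lt measurable_const measurable_l1Norm).inter (measurable_direction hA)
  rw [h.polar_eq _ hm h0, polar_image h0]
  have : {p : ℝ≥0 × (Fin N → ℝ≥0) | p.2 ∈ stdSimplex ℝ≥0 (Fin N) ∧
      p.1 • p.2 ∈ {z | 1 < l1Norm z ∧ direction z ∈ A}} =
      Set.Ioi 1 ×ˢ (A ∩ stdSimplex ℝ≥0 (Fin N)) := by
    ext ⟨r, s⟩
    simp only [Set.mem_ofPred_eq, Set.mem_prod, Set.mem_Ioi, Set.mem_inter_iff]
    constructor
    · rintro ⟨hs, hr, hA⟩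
      rw [l1Norm_smul, mem_stdSimplex_iff.1 hs, mul_one] at hr
      rw [direction_smul (by positivity), direction_of_mem_stdSimplex hs] at hA
      exact ⟨hr, hA, hs⟩
    · rintro ⟨hr, hA, hs⟩
      rw [l1Norm_smul, mem_stdSimplex_iff.1 hs, mul_one, direction_smul (by positivity),
        direction_of_mem_stdSimplex hs]
      exact ⟨hs, hr, hA⟩
  rw [this, Measure.prod_prod, radialMeasure_Ioi _ one_ne_zero,
    measure_inter_conull' (measure_mono_null (fun z hz => hz.2) h.simplex)]
  have hN0 : (N : ℝ≥0∞) ≠ 0 := by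
    simp; omega
  simp [← mul_assoc, ENNReal.inv_mul_cancel hN0]

lemma IsSpectralMeasure.unique {μ H H' : Measure (Fin N → ℝ≥0)} (hN : 1 ≤ N)
    (h : IsSpectralMeasure μ H) (h' : IsSpectralMeasure μ H') : H = H' :=
  Measure.ext fun _ hA => (h.measure_eq hN hA).trans (h'.measure_eq hN hA).symm

end Directions

/-! ### Existence of the spectral measure -/

section Spectral

variable {X : Type*} [TopologicalSpace X] {N : ℕ}

variable [MeasurableSpace C(X, ℝ≥0)] [BorelSpace C(X, ℝ≥0)]

@[fun_prop]
lemma measurable_restr (x : Fin N → X) : Measurable (restr x) :=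
  measurable_pi_lambda _ fun j => (continuous_eval_const (x j)).measurable

@[fun_prop]
lemma measurable_eval (y : X) : Measurable fun f : C(X, ℝ≥0) => f y :=
  (continuous_eval_const y).measurable

/-- The law of `f(x) / ‖f(x)‖` under `N⁻¹ ‖f(x)‖ ν(df)`. -/
noncomputable def spectralMeasure (ν : Measure C(X, ℝ≥0)) (x : Fin N → X) :
    Measure (Fin N → ℝ≥0) :=
  (N : ℝ≥0∞)⁻¹ • (ν.withDensity fun f => (l1Norm (restr x f) : ℝ≥0∞)).map
    fun f => direction (restr x f)

lemma lintegral_spectralMeasure (ν : Measure C(X, ℝ≥0)) (x : Fin N → X)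
    {g : (Fin N → ℝ≥0) → ℝ≥0∞} (hg : Measurable g) :
    ∫⁻ s, g s ∂spectralMeasure ν x =
      (N : ℝ≥0∞)⁻¹ * ∫⁻ f, l1Norm (restr x f) * g (direction (restr x f)) ∂ν := by
  rw [spectralMeasure, lintegral_smul_measure, lintegral_map hg (by fun_prop),
    lintegral_withDensity_eq_lintegral_mul _ (by fun_prop) (by fun_prop)]
  rfl

lemma lintegral_l1Norm_restr (ν : Measure C(X, ℝ≥0)) (hν : ∀ y : X, ∫⁻ f, (f y : ℝ≥0∞) ∂ν = 1)
    (x : Fin N → X) : ∫⁻ f, (l1Norm (restr x f) : ℝ≥0∞) ∂ν = N := by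
  simp only [l1Norm, restr, ENNReal.ofNNReal_finsetSum]
  rw [lintegral_finsetSum _ (by fun_prop)]
  simp [hν]

/-- Homogeneity along the ray through `z`. For `z = 0` both sides vanish because `0 ∉ F`. -/
lemma radialMeasure_smul_mem (z : Fin N → ℝ≥0) {F : Set (Fin N → ℝ≥0)} (hF : MeasurableSet F)
    (h0 : 0 ∉ F) :
    radialMeasure 1 {r | r • z ∈ F} = l1Norm z * radialMeasure 1 {r | r • direction z ∈ F} := by
  by_cases hz : l1Norm z = 0
  · simp [l1Norm_eq_zero.1 hz, l1Norm, h0]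
  · have hm : MeasurableSet {r : ℝ≥0 | r • direction z ∈ F} :=
      (measurable_id.smul_const (direction z)) hF
    have hm' : MeasurableSet {r : ℝ≥0 | r • z ∈ F} := (measurable_id.smul_const z) hF
    rw [← lintegral_indicator_one hm, ← lintegral_indicator_one hm',
      ← lintegral_radialMeasure_comp_mul hz (measurable_one.indicator hm)]
    refine lintegral_congr fun r => ?_
    have : (l1Norm z * r) • direction z = r • z := by
      rw [mul_comm, mul_smul, l1Norm_smul_direction]
    by_cases h : r • z ∈ F
    · rw [Set.indicator_of_mem (by exact h), Set.indicator_of_mem (by simpa [this] using h)]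
      rfl
    · rw [Set.indicator_of_notMem (by exact h), Set.indicator_of_notMem (by simpa [this] using h)]

/-- After Fubini the polar identity holds for each `f` separately, by `radialMeasure_smul_mem`; the
factor `N` of the radial measure cancels the normalisation. -/
lemma isSpectralMeasure_spectralMeasure (ν : Measure C(X, ℝ≥0)) [SFinite ν]
    (hν : ∀ y : X, ∫⁻ f, (f y : ℝ≥0∞) ∂ν = 1) (hN : 1 ≤ N) (x : Fin N → X) :
    IsSpectralMeasure (exponentMeasure ν x) (spectralMeasure ν x) := by
  have hN0 : (N : ℝ≥0∞) ≠ 0 := by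
    simp; omega
  have hprob : IsProbabilityMeasure (spectralMeasure ν x) := by
    refine ⟨?_⟩
    rw [← lintegral_one, lintegral_spectralMeasure ν x measurable_const]
    simp [lintegral_l1Norm_restr ν hν, ENNReal.inv_mul_cancel hN0]
  have hsimp : spectralMeasure ν x (stdSimplex ℝ≥0 (Fin N))ᶜ = 0 := by
    rw [← lintegral_indicator_one measurableSet_stdSimplex.compl,
      lintegral_spectralMeasure ν x (measurable_one.indicator measurableSet_stdSimplex.compl)]
    have : ∀ f : C(X, ℝ≥0), (l1Norm (restr x f) : ℝ≥0∞) *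
        (stdSimplex ℝ≥0 (Fin N))ᶜ.indicator 1 (direction (restr x f)) = 0 := by
      intro f
      by_cases hf : restr x f = 0
      · simp [l1Norm_eq_zero.2 hf]
      · simp [direction_mem_stdSimplex hf]
    simp [this]
  refine ⟨hprob, hsimp, fun F hF h0 => ?_⟩
  have hF' : MeasurableSet {p : ℝ≥0 × (Fin N → ℝ≥0) | p.1 • p.2 ∈ F} :=
    (measurable_fst.smul measurable_snd) hF
  have hm : Measurable fun p : ℝ≥0 × C(X, ℝ≥0) => p.1 • restr x p.2 :=
    measurable_fst.smul ((measurable_restr x).comp measurable_snd)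
  rw [prod_polar_image hsimp h0, Measure.prod_apply_symm hF',
    lintegral_spectralMeasure ν x (measurable_measure_prodMk_right hF'),
    exponentMeasure, Measure.map_apply hm hF, Measure.prod_apply_symm (hm hF),
    ← lintegral_const_mul' _ _ (by simpa using hN0)]
  refine lintegral_congr fun f => ?_
  rw [radialMeasure_eq_smul N, Measure.smul_apply]
  refine (radialMeasure_smul_mem (restr x f) hF h0).trans ?_
  simp only [ENNReal.coe_natCast, smul_eq_mul, Set.preimage_ofPred_eq]
  rw [mul_left_comm _ (N : ℝ≥0∞), ← mul_assoc (N : ℝ≥0∞)⁻¹, ENNReal.inv_mul_cancel hN0 (by simp),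
    one_mul]

lemma existsUnique_isSpectralMeasure (ν : Measure C(X, ℝ≥0)) [SFinite ν]
    (hν : ∀ y : X, ∫⁻ f, (f y : ℝ≥0∞) ∂ν = 1) (hN : 1 ≤ N) (x : Fin N → X) :
    ∃! H, IsSpectralMeasure (exponentMeasure ν x) H :=
  ⟨spectralMeasure ν x, isSpectralMeasure_spectralMeasure ν hν hN x,
    fun _ h => h.unique hN (isSpectralMeasure_spectralMeasure ν hν hN x)⟩

end Spectral

/-! ### Random directions -/

section RandomDirection

lemma measurable_select {N : ℕ} {S : Type*} [MeasurableSpace S] :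
    Measurable fun p : Fin N × (Fin N → S) => p.2 p.1 :=
  measurable_from_prod_countable_right measurable_pi_apply

lemma measurable_select_comp {Ω S : Type*} [MeasurableSpace Ω] [MeasurableSpace S] {N : ℕ}
    {T : Ω → Fin N} {Y : Fin N → Ω → S} (hT : Measurable T) (hY : ∀ k, Measurable (Y k)) :
    Measurable fun ω => Y (T ω) ω :=
  measurable_select.comp (hT.prodMk (measurable_pi_lambda (fun ω k => Y k ω) hY))

/-- Split according to the value of `T`; only independence of `T` from each single `Y k` enters. -/
lemma measure_select_mem {Ω S : Type*} [MeasurableSpace Ω] [MeasurableSpace S] {P : Measure Ω}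
    {N : ℕ} {T : Ω → Fin N} {Y : Fin N → Ω → S} (hT : Measurable T)
    (hY : ∀ k, Measurable (Y k)) (hTlaw : HasLaw T (uniformOn Set.univ) P)
    (hTY : IndepFun T (fun ω k => Y k ω) P) {A : Set S} (hA : MeasurableSet A) :
    P {ω | Y (T ω) ω ∈ A} = (N : ℝ≥0∞)⁻¹ * ∑ k, P (Y k ⁻¹' A) := by
  have hsplit : {ω | Y (T ω) ω ∈ A} = ⋃ k, (T ⁻¹' {k} ∩ Y k ⁻¹' A) := by
    ext ω
    simp
  have hdisj : Pairwise (Function.onFun Disjoint fun k => T ⁻¹' {k} ∩ Y k ⁻¹' A) := fun k l hkl =>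
    Set.disjoint_left.2 fun ω hk hl => hkl (hk.1.symm.trans hl.1)
  rw [hsplit, measure_iUnion hdisj fun k => (hT (measurableSet_singleton k)).inter (hY k hA),
    tsum_fintype, Finset.mul_sum]
  refine Finset.sum_congr rfl fun k _ => ?_
  have hind : IndepFun T (Y k) P := hTY.comp measurable_id (measurable_pi_apply k)
  rw [hind.measure_inter_preimage_eq_mul _ _ (measurableSet_singleton k) hA,
    ← Measure.map_apply hT (measurableSet_singleton k), hTlaw.map_eq, uniformOn_univ]
  simp

variable {X : Type*} [TopologicalSpace X] [MeasurableSpace C(X, ℝ≥0)] [BorelSpace C(X, ℝ≥0)]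
  {N : ℕ}

variable [LocallyCompactSpace X] [SecondCountableTopology X]

lemma measurable_inv_eval_smul (y : X) : Measurable fun f : C(X, ℝ≥0) => (f y)⁻¹ • f :=
  (measurable_eval y).inv.smul measurable_id

/-- Directions are unchanged by division by `f (x k)`; where this value is zero, the density
vanishes. -/
lemma extremalLaw_direction (ν : Measure C(X, ℝ≥0)) (x : Fin N → X) (k : Fin N)
    {A : Set (Fin N → ℝ≥0)} (hA : MeasurableSet A) :
    extremalLaw ν (x k) {f | direction (restr x f) ∈ A} =
      ∫⁻ f, f (x k) * A.indicator 1 (direction (restr x f)) ∂ν := by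
  have hm : MeasurableSet {f : C(X, ℝ≥0) | direction (restr x f) ∈ A} :=
    (measurable_direction.comp (measurable_restr x)) hA
  rw [extremalLaw, Measure.map_apply (measurable_inv_eval_smul _) hm, ← lintegral_indicator_one
      (measurable_inv_eval_smul _ hm), lintegral_withDensity_eq_lintegral_mul _ (by fun_prop)
      (measurable_one.indicator (measurable_inv_eval_smul _ hm))]
  refine lintegral_congr fun f => ?_
  rw [Pi.mul_apply]
  by_cases hf : f (x k) = 0
  · simp [hf]
  · have : direction (restr x ((f (x k))⁻¹ • f)) = direction (restr x f) :=
      direction_smul (inv_ne_zero hf) (restr x f)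
    congr 1
    by_cases h : direction (restr x f) ∈ A
    · rw [Set.indicator_of_mem h, Set.indicator_of_mem (by simpa [this] using h)]
      rfl
    · rw [Set.indicator_of_notMem h, Set.indicator_of_notMem (by simpa [this] using h)]

/-- The densities `f (x k)` sum over `k` to `‖f(x)‖`. -/
lemma map_select_direction {Ω : Type*} [MeasurableSpace Ω] {P : Measure Ω}
    (ν : Measure C(X, ℝ≥0)) (x : Fin N → X)
    {T : Ω → Fin N} {Y : Fin N → Ω → C(X, ℝ≥0)} (hT : Measurable T) (hY : ∀ k, Measurable (Y k))
    (hTlaw : HasLaw T (uniformOn Set.univ) P)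
    (hYlaw : ∀ k, HasLaw (Y k) (extremalLaw ν (x k)) P)
    (hTY : IndepFun T (fun ω k => Y k ω) P) :
    P.map (fun ω => direction (restr x (Y (T ω) ω))) = spectralMeasure ν x := by
  have hQ : Measurable fun ω => direction (restr x (Y (T ω) ω)) :=
    measurable_direction.comp ((measurable_restr x).comp (measurable_select_comp hT hY))
  ext A hA
  have hA' : MeasurableSet {f : C(X, ℝ≥0) | direction (restr x f) ∈ A} :=
    (measurable_direction.comp (measurable_restr x)) hA
  have hk : ∀ k, P (Y k ⁻¹' {f | direction (restr x f) ∈ A}) =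
      ∫⁻ f, f (x k) * A.indicator 1 (direction (restr x f)) ∂ν := by
    intro k
    rw [← Measure.map_apply (hY k) hA', (hYlaw k).map_eq, extremalLaw_direction ν x k hA]
  rw [Measure.map_apply hQ hA, ← lintegral_indicator_one hA,
    lintegral_spectralMeasure ν x (measurable_one.indicator hA)]
  refine (measure_select_mem hT hY hTlaw hTY hA').trans ?_
  simp only [hk]
  rw [← lintegral_finsetSum]
  · simp only [← Finset.sum_mul, l1Norm, restr, ENNReal.ofNNReal_finsetSum]
  · intro k _
    exact Measurable.mul (by fun_prop)
      ((measurable_one.indicator hA).comp (measurable_direction.comp (measurable_restr x)))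

end RandomDirection

/-! ### Poisson processes -/

section Poisson

lemma lintegral_pow_poissonMeasure (r : ℝ≥0) {c : ℝ≥0} (hc : c ≤ 1) :
    ∫⁻ n, (c : ℝ≥0∞) ^ n ∂poissonMeasure r =
      ENNReal.ofReal (Real.exp (-((r : ℝ≥0∞) * (1 - c)).toReal)) := by
  rw [lintegral_countable']
  simp only [poissonMeasure_singleton]
  -- Tilting by `c ^ n` yields the Poisson weights of mean `r * c`, up to the constant `exp (r * c -
  -- r)`.
  have hsum := (hasSum_one_poissonMeasure (r * c)).mul_left (Real.exp (r * c - r))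
  have hterm : ∀ n : ℕ, (c : ℝ≥0∞) ^ n * ENNReal.ofReal (Real.exp (-r) * r ^ n / n.factorial) =
      ENNReal.ofReal (Real.exp (r * c - r) *
        (Real.exp (-(r * c : ℝ≥0)) * (r * c : ℝ≥0) ^ n / n.factorial)) := by
    intro n
    rw [← ENNReal.coe_pow, ← ENNReal.ofReal_coe_nnreal, ← ENNReal.ofReal_mul (by positivity)]
    congr 1
    push_cast
    rw [mul_div_assoc (Real.exp (-(r * c : ℝ))), ← mul_assoc, ← Real.exp_add, mul_pow]
    rw [show (r * c - r + -(r * c) : ℝ) = -r by ring]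
    ring
  have hexp : ((r : ℝ≥0∞) * (1 - c)).toReal = r * (1 - c) := by
    rw [ENNReal.toReal_mul, ENNReal.toReal_sub_of_le (by exact_mod_cast hc) ENNReal.one_ne_top]
    simp
  simp only [hterm]
  rw [← ENNReal.ofReal_tsum_of_nonneg (fun n => by positivity) hsum.summable, hsum.tsum_eq, hexp]
  congr 1
  rw [mul_one]
  congr 1
  ring

namespace IsPoissonProcess

lemma tprod_eq_finset_prod {S : Type*} {B : Set S} {g : S → ℝ≥0} (hg : ∀ s ∉ B, g s = 1) {q : ℕ → S}
    (hq : {i | q i ∈ B}.Finite) :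
    ∏' i, (g (q i) : ℝ≥0∞) = ((∏ i ∈ hq.toFinset, g (q i) : ℝ≥0) : ℝ≥0∞) := by
  rw [tprod_eq_prod (s := hq.toFinset), ENNReal.ofNNReal_finsetProd]
  intro i hi
  rw [hg _ (by simpa using hi), ENNReal.coe_one]

variable {Ω S : Type*} [MeasurableSpace Ω] [MeasurableSpace S] {p : ℕ → Ω → S} {Λ : Measure S}
  {P : Measure Ω}

lemma measurable_count (hp : IsPoissonProcess p Λ P) {B : Set S} (hB : MeasurableSet B) :
    Measurable fun ω => {i | p i ω ∈ B}.encard :=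
  measurable_encard.comp (measurable_set_iff.2 fun i => hp.measurable i hB |>.mem)

lemma ae_finite (hp : IsPoissonProcess p Λ P) {B : Set S} (hB : MeasurableSet B) (hΛ : Λ B ≠ ∞) :
    ∀ᵐ ω ∂P, {i | p i ω ∈ B}.Finite := by
  have := ((hp.hasLaw_count B hB hΛ).ae_iff (p := fun n => n ≠ ⊤) (by fun_prop)).2
    ((ae_map_iff (by fun_prop) (MeasurableSet.of_discrete)).2 (by simp))
  filter_upwards [this] with ω hω
  exact Set.encard_ne_top_iff.1 hω

/-- The law of the count is carried by `ℕ`, so the default value of `toNat` at `⊤` is harmless. -/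
lemma lintegral_pow_count (hp : IsPoissonProcess p Λ P) {B : Set S} (hB : MeasurableSet B)
    (hΛ : Λ B ≠ ∞) {c : ℝ≥0} (hc : c ≤ 1) :
    ∫⁻ ω, (c : ℝ≥0∞) ^ {i | p i ω ∈ B}.encard.toNat ∂P =
      ENNReal.ofReal (Real.exp (-(Λ B * (1 - c)).toReal)) := by
  rw [(hp.hasLaw_count B hB hΛ).lintegral_comp (f := fun n : ℕ∞ => (c : ℝ≥0∞) ^ n.toNat)
      (Measurable.aemeasurable .of_discrete), lintegral_map .of_discrete .of_discrete]
  simp only [ENat.toNat_natCast]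
  rw [lintegral_pow_poissonMeasure _ hc, ENNReal.coe_toNNReal hΛ]

lemma measure_forall_notMem (hp : IsPoissonProcess p Λ P) {B : Set S} (hB : MeasurableSet B)
    (hΛ : Λ B ≠ ∞) :
    P {ω | ∀ i, p i ω ∉ B} = ENNReal.ofReal (Real.exp (-(Λ B).toReal)) := by
  have h := (hp.hasLaw_count B hB hΛ).measure_eq (p := fun n => n = 0) .of_discrete
  have : {ω | {i | p i ω ∈ B}.encard = 0} = {ω | ∀ i, p i ω ∉ B} := by
    ext ω
    simp [Set.eq_empty_iff_forall_notMem]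
  rw [this] at h
  rw [h, Measure.map_apply .of_discrete .of_discrete]
  have : (Nat.cast : ℕ → ℕ∞) ⁻¹' {n | n = 0} = {0} := by
    ext n; simp
  rw [this, poissonMeasure_singleton]
  simp [ENNReal.toReal]

lemma lintegral_prod_pow_count (hp : IsPoissonProcess p Λ P) {m : ℕ} {B : Fin m → Set S}
    (hB : ∀ k, MeasurableSet (B k)) (hd : Pairwise fun k l => Disjoint (B k) (B l))
    (hΛ : ∀ k, Λ (B k) ≠ ∞) {c : Fin m → ℝ≥0} (hc : ∀ k, c k ≤ 1) :
    ∫⁻ ω, ∏ k, (c k : ℝ≥0∞) ^ {i | p i ω ∈ B k}.encard.toNat ∂P =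
      ENNReal.ofReal (Real.exp (-(∑ k, Λ (B k) * (1 - c k)).toReal)) := by
  have hind := (hp.indep_count m B hB hd).comp (fun k (n : ℕ∞) => (c k : ℝ≥0∞) ^ n.toNat)
    fun _ => .of_discrete
  have hk : ∀ k, ∫⁻ ω, ((fun n : ℕ∞ => (c k : ℝ≥0∞) ^ n.toNat) ∘
      fun ω => {i | p i ω ∈ B k}.encard) ω ∂P =
        ENNReal.ofReal (Real.exp (-(Λ (B k) * (1 - c k)).toReal)) :=
    fun k => hp.lintegral_pow_count (hB k) (hΛ k) (hc k)
  refine (lintegral_prod_eq_prod_lintegral_of_indepFun Finset.univ _ hind fun k =>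
    Measurable.comp .of_discrete (hp.measurable_count (hB k))).trans ?_
  rw [Finset.prod_congr rfl fun k _ => hk k,
    ← ENNReal.ofReal_prod_of_nonneg (fun _ _ => (Real.exp_pos _).le), ← Real.exp_sum,
    Finset.sum_neg_distrib, ENNReal.toReal_sum]
  exact fun k _ => ENNReal.mul_ne_top (hΛ k) (by simp)

/-- Grouping the factors by the value of `h` turns the product into powers of the `c k`, with the
independent counts of the disjoint sets `h ⁻¹' {k} ∩ B` as exponents. -/
lemma lintegral_tprod_of_finite_range (hp : IsPoissonProcess p Λ P) {m : ℕ} {h : S → Fin m}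
    (hh : Measurable h) {c : Fin m → ℝ≥0} (hc : ∀ k, c k ≤ 1) {B : Set S} (hB : MeasurableSet B)
    (hΛ : Λ B ≠ ∞) (hcB : ∀ s ∉ B, c (h s) = 1) :
    ∫⁻ ω, ∏' i, (c (h (p i ω)) : ℝ≥0∞) ∂P =
      ENNReal.ofReal (Real.exp (-(∫⁻ s in B, (1 - c (h s)) ∂Λ).toReal)) := by
  have hm : ∀ k, MeasurableSet (h ⁻¹' {k} ∩ B) := fun k =>
    (hh (measurableSet_singleton k)).inter hB
  have hint : ∫⁻ s in B, (1 - c (h s)) ∂Λ = ∑ k, Λ (h ⁻¹' {k} ∩ B) * (1 - c k) := by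
    rw [← lintegral_map (f := fun k => (1 - c k : ℝ≥0∞)) .of_discrete hh, lintegral_fintype]
    refine Finset.sum_congr rfl fun k _ => ?_
    rw [Measure.map_apply hh (measurableSet_singleton k),
      Measure.restrict_apply (hh (measurableSet_singleton k)), mul_comm]
  rw [hint, ← hp.lintegral_prod_pow_count hm _
    (fun k => ((measure_mono Set.inter_subset_right).trans_lt hΛ.lt_top).ne) hc]
  · refine lintegral_congr_ae ?_
    filter_upwards [hp.ae_finite hB hΛ] with ω hω
    rw [tprod_eq_finset_prod (g := fun s => c (h s)) hcB hω,
      ← Finset.prod_fiberwise (s := hω.toFinset) (g := fun i => h (p i ω)),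
      ENNReal.ofNNReal_finsetProd]
    refine Finset.prod_congr rfl fun k _ => ?_
    rw [Finset.prod_congr rfl (g := fun _ => c k) fun i hi => by
      rw [(Finset.mem_filter.1 hi).2], Finset.prod_const, ENNReal.coe_pow]
    congr 1
    have : {i | p i ω ∈ h ⁻¹' {k} ∩ B} =
        ((hω.toFinset.filter fun i => h (p i ω) = k : Finset ℕ) : Set ℕ) := by
      ext i; simp [and_comm]
    rw [this, Set.encard_coe_eq_coe_finsetCard, ENat.toNat_natCast]
  · intro k l hkl
    refine Set.disjoint_left.2 fun s hk hl => hkl ?_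
    exact hk.1.symm.trans hl.1

/-- The probability generating functional of a Poisson process. -/
lemma lintegral_tprod [IsProbabilityMeasure P] (hp : IsPoissonProcess p Λ P) {g : S → ℝ≥0}
    (hg : Measurable g) (hg1 : ∀ s, g s ≤ 1) {B : Set S} (hB : MeasurableSet B) (hΛ : Λ B ≠ ∞)
    (hgB : ∀ s ∉ B, g s = 1) :
    ∫⁻ ω, ∏' i, (g (p i ω) : ℝ≥0∞) ∂P =
      ENNReal.ofReal (Real.exp (-(∫⁻ s in B, (1 - g s) ∂Λ).toReal)) := by
  -- Round `g` down to multiples of `1 / (n + 1)`. The `n + 2` levels include 1, so the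
  -- approximations are still exactly 1 off `B`.
  set h : ∀ n : ℕ, S → Fin (n + 2) := fun n s =>
    ⟨⌊(n + 1 : ℕ) * g s⌋₊, by
      have : ⌊(n + 1 : ℕ) * g s⌋₊ ≤ n + 1 := by
        refine Nat.floor_le_of_le ?_
        exact mul_le_of_le_one_right zero_le (hg1 s)
      omega⟩ with hh
  set c : ∀ n : ℕ, Fin (n + 2) → ℝ≥0 := fun n k => (k : ℕ) / (n + 1 : ℕ) with hc
  have hhm : ∀ n, Measurable (h n) := by
    intro n
    refine measurable_to_countable' fun k => ?_
    have : h n ⁻¹' {k} = (fun s => ⌊(n + 1 : ℕ) * g s⌋₊) ⁻¹' {(k : ℕ)} := by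
      ext s; simp [hh, Fin.ext_iff]
    rw [this]
    exact (Nat.measurable_floor.comp (hg.const_mul _)) (measurableSet_singleton _)
  have hc1 : ∀ n k, c n k ≤ 1 := by
    intro n k
    refine div_le_one_of_le₀ ?_ zero_le
    exact_mod_cast Nat.lt_succ_iff.1 k.2
  have hcB : ∀ n, ∀ s ∉ B, c n (h n s) = 1 := by
    intro n s hs
    simp only [hc, hh, hgB s hs, mul_one, Nat.floor_natCast]
    exact div_self (by positivity)
  have hlim : ∀ s, Filter.Tendsto (fun n => c n (h n s)) Filter.atTop (nhds (g s)) := by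
    intro s
    rw [← NNReal.tendsto_coe]
    have := (tendsto_nat_floor_mul_div_atTop (g s).coe_nonneg).comp
      ((tendsto_natCast_atTop_atTop (R := ℝ)).comp (Filter.tendsto_add_atTop_nat 1))
    refine this.congr fun n => ?_
    have hfloor : ⌊((n + 1 : ℕ) * g s : ℝ≥0)⌋₊ = ⌊(g s : ℝ) * (n + 1 : ℕ)⌋₊ := by
      rw [mul_comm, show ⌊(g s * (n + 1 : ℕ) : ℝ≥0)⌋₊ = ⌊((g s * (n + 1 : ℕ) : ℝ≥0) : ℝ)⌋₊ from rfl]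
      simp
    simp only [hc, hh, hfloor, Function.comp]
    simp
  have hL : Filter.Tendsto (fun n => ∫⁻ ω, ∏' i, (c n (h n (p i ω)) : ℝ≥0∞) ∂P) Filter.atTop
      (nhds (∫⁻ ω, ∏' i, (g (p i ω) : ℝ≥0∞) ∂P)) := by
    refine tendsto_lintegral_of_dominated_convergence 1 (fun n => ?_) (fun n => ?_) (by simp) ?_
    -- With factors at most 1, the infinite product is a countable infimum of finite products, hence
    -- measurable.
    · have : ∀ ω, ∏' i, (c n (h n (p i ω)) : ℝ≥0∞) =
          ⨅ s : Finset ℕ, ∏ i ∈ s, (c n (h n (p i ω)) : ℝ≥0∞) := fun ω =>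
        ENNReal.tprod_eq_iInf_prod fun i => by exact_mod_cast hc1 n (h n (p i ω))
      simp only [this]
      refine Measurable.iInf fun s => Finset.measurable_prod _ fun i _ => ?_
      have : Measurable (c n) := .of_discrete
      exact (this.comp ((hhm n).comp (hp.measurable i))).coe_nnreal_ennreal
    · refine Filter.Eventually.of_forall fun ω => ?_
      change ∏' i, (c n (h n (p i ω)) : ℝ≥0∞) ≤ 1
      rw [ENNReal.tprod_eq_iInf_prod (f := fun i => (c n (h n (p i ω)) : ℝ≥0∞))
        fun i => by exact_mod_cast hc1 n _]
      exact iInf_le_of_le ∅ (by simp)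
    · filter_upwards [hp.ae_finite hB hΛ] with ω hω
      rw [tprod_eq_finset_prod hgB hω]
      simp only [tprod_eq_finset_prod (g := fun s => c _ (h _ s)) (hcB _) hω]
      exact ENNReal.tendsto_coe.2 (tendsto_finsetProd _ fun i _ => hlim _)
  have hI : Filter.Tendsto (fun n => ∫⁻ s in B, (1 - c n (h n s)) ∂Λ) Filter.atTop
      (nhds (∫⁻ s in B, (1 - g s) ∂Λ)) := by
    refine tendsto_lintegral_of_dominated_convergence 1 (fun n => ?_) (fun n => ?_) (by simpa) ?_
    · have : Measurable (c n) := .of_discrete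
      exact measurable_const.sub (this.comp (hhm n)).coe_nnreal_ennreal
    · exact Filter.Eventually.of_forall fun s => tsub_le_self
    · refine Filter.Eventually.of_forall fun s => ?_
      exact ENNReal.Tendsto.sub tendsto_const_nhds (ENNReal.tendsto_coe.2 (hlim s)) (by simp)
  -- Finiteness makes `toReal` continuous at the limit.
  have hfin : ∫⁻ s in B, (1 - g s) ∂Λ ≠ ∞ := by
    refine ((setLIntegral_mono measurable_const (g := 1) fun s _ => ?_).trans_lt ?_).ne
    · exact tsub_le_self
    · simpa using hΛ.lt_top
  refine tendsto_nhds_unique hL ?_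
  simp only [fun n => hp.lintegral_tprod_of_finite_range (hhm n) (hc1 n) hB hΛ (hcB n)]
  exact ENNReal.tendsto_ofReal ((Real.continuous_exp.tendsto _).comp
    ((ENNReal.tendsto_toReal hfin).comp hI).neg)

end IsPoissonProcess

end Poisson

/-! ### Attained suprema and laws of maxima -/

/-- A nonzero term exceeds some level `1 / (n + 1)`, and the maximum is then taken over the finitely
many terms above it. -/
lemma isGreatest_iSup_of_finite {u : ℕ → ℝ≥0}
    (hu : ∀ n : ℕ, {i | 1 / ((n : ℝ≥0) + 1) < u i}.Finite) :
    IsGreatest (Set.range u) (⨆ i, u i) := by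
  suffices h : ∃ m, ∀ i, u i ≤ u m by
    obtain ⟨m, hm⟩ := h
    have : ⨆ i, u i = u m :=
      le_antisymm (ciSup_le hm) (le_ciSup ⟨u m, Set.forall_mem_range.2 hm⟩ m)
    rw [this]
    exact ⟨Set.mem_range_self m, Set.forall_mem_range.2 hm⟩
  by_cases h0 : ∀ i, u i = 0
  · exact ⟨0, fun i => by simp [h0]⟩
  · push Not at h0
    obtain ⟨k, hk⟩ := h0
    obtain ⟨n, hn⟩ := exists_nat_one_div_lt (pos_iff_ne_zero.2 hk)
    obtain ⟨m, hm, hmax⟩ := Set.exists_max_image _ u (hu n) ⟨k, hn⟩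
    refine ⟨m, fun i => ?_⟩
    by_cases hi : 1 / ((n : ℝ≥0) + 1) < u i
    · exact hmax i hi
    · exact (not_lt.1 hi).trans (le_of_lt hm)

/-- Right-continuity of distribution functions recovers thresholds with zero coordinates, where the
exponents below could be infinite. -/
lemma ext_of_Iic_ne_zero {N : ℕ} {μ ν : Measure (Fin N → ℝ≥0)} [IsProbabilityMeasure μ]
    [IsProbabilityMeasure ν]
    (h : ∀ z : Fin N → ℝ≥0, (∀ j, z j ≠ 0) → μ (Set.Iic z) = ν (Set.Iic z)) : μ = ν := by
  have hall : ∀ z : Fin N → ℝ≥0, μ (Set.Iic z) = ν (Set.Iic z) := by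
    intro z
    set w : ℕ → Fin N → ℝ≥0 := fun n j => z j + 1 / ((n : ℝ≥0) + 1) with hw
    have hinter : Set.Iic z = ⋂ n, Set.Iic (w n) := by
      ext y
      simp only [Set.mem_Iic, Set.mem_iInter, Pi.le_def, hw]
      refine ⟨fun hy n j => (hy j).trans (le_add_of_nonneg_right zero_le), fun hy j => ?_⟩
      refine le_of_forall_pos_le_add fun ε hε => ?_
      obtain ⟨n, hn⟩ := exists_nat_one_div_lt hε
      exact (hy n j).trans (add_le_add_right hn.le _)
    have hanti : Antitone fun n => Set.Iic (w n) := by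
      intro m n hmn
      refine Set.Iic_subset_Iic.2 fun j => add_le_add_right ?_ _
      exact one_div_le_one_div_of_le (by positivity) (by gcongr)
    have hlim : ∀ (ρ : Measure (Fin N → ℝ≥0)) [IsProbabilityMeasure ρ],
        Filter.Tendsto (fun n => ρ (Set.Iic (w n))) Filter.atTop (nhds (ρ (Set.Iic z))) := by
      intro ρ _
      rw [hinter]
      exact tendsto_measure_iInter_atTop (fun n => measurableSet_Iic.nullMeasurableSet) hanti
        ⟨0, measure_ne_top _ _⟩
    refine tendsto_nhds_unique (hlim μ) ?_
    refine (hlim ν).congr fun n => (h _ fun j => ?_).symm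
    positivity
  refine ext_of_generate_finite (Set.univ.pi '' Set.univ.pi fun _ : Fin N => Set.range Set.Iic)
    (generateFrom_eq_pi (fun _ => ?_) fun _ => ?_).symm
    (IsPiSystem.pi fun _ => isPiSystem_Iic) ?_ (by simp)
  · rw [← borel_eq_generateFrom_Iic, BorelSpace.measurable_eq (α := ℝ≥0)]
  · refine ⟨fun n => Set.Iic (n : ℝ≥0), fun n => ⟨n, rfl⟩, ?_⟩
    exact Set.eq_univ_of_forall fun r => Set.mem_iUnion.2 (exists_nat_ge r)
  · rintro _ ⟨s, hs, rfl⟩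
    choose z hz using fun j => hs j (Set.mem_univ j)
    have : Set.univ.pi s = Set.Iic z := by
      rw [← Set.pi_univ_Iic]
      exact congrArg _ (funext fun j => (hz j).symm)
    rw [this, hall z]

/-! ### Exponent measures of sets away from the origin -/

section Representation

variable {N : ℕ}

lemma IsSpectralMeasure.measure_lt_top {μ H : Measure (Fin N → ℝ≥0)} (h : IsSpectralMeasure μ H)
    {F : Set (Fin N → ℝ≥0)} (hF : MeasurableSet F) {t : ℝ≥0} (ht : t ≠ 0)
    (hFt : ∀ z ∈ F, t < l1Norm z) : μ F < ∞ := by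
  have := h.isProbabilityMeasure
  have h0 : 0 ∉ F := fun h0 => by simpa [l1Norm] using hFt 0 h0
  rw [h.polar_eq F hF h0, polar_image h0]
  refine (measure_mono (t := Set.Ioi t ×ˢ Set.univ) ?_).trans_lt ?_
  · rintro ⟨r, s⟩ ⟨hs, hrs⟩
    have := hFt _ hrs
    rw [l1Norm_smul, mem_stdSimplex_iff.1 hs, mul_one] at this
    exact ⟨this, Set.mem_univ _⟩
  · rw [Measure.prod_prod, radialMeasure_Ioi _ ht, measure_univ, mul_one]
    exact ENNReal.mul_lt_top (by simp) (by simp [ht, pos_iff_ne_zero])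

lemma lt_l1Norm_of_not_le {z w : Fin N → ℝ≥0} {t : ℝ≥0} (ht : ∀ j, t ≤ z j) (h : ¬ w ≤ z) :
    t < l1Norm w := by
  obtain ⟨j, hj⟩ := not_forall.1 h
  exact ((ht j).trans_lt (not_le.1 hj)).trans_le
    (Finset.single_le_sum (f := w) (fun _ _ => zero_le) (Finset.mem_univ j))

lemma exists_pos_le (z : Fin N → ℝ≥0) (hz : ∀ j, z j ≠ 0) : ∃ t ≠ 0, ∀ j, t ≤ z j := by
  rcases isEmpty_or_nonempty (Fin N) with hN | hN
  · exact ⟨1, one_ne_zero, fun j => isEmptyElim j⟩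
  · obtain ⟨k, hk⟩ := Finite.exists_min z
    exact ⟨z k, hz k, hk⟩

lemma measurableSet_not_le (z : Fin N → ℝ≥0) : MeasurableSet {w : Fin N → ℝ≥0 | ¬ w ≤ z} :=
  measurableSet_Iic.compl

lemma measurableSet_smul_not_le (z : Fin N → ℝ≥0) :
    MeasurableSet {p : ℝ≥0 × (Fin N → ℝ≥0) | ¬ p.1 • p.2 ≤ z} :=
  (measurable_fst.smul measurable_snd) (measurableSet_not_le z)

lemma IsSpectralMeasure.measure_not_le {μ H : Measure (Fin N → ℝ≥0)} (h : IsSpectralMeasure μ H)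
    (z : Fin N → ℝ≥0) :
    μ {w | ¬ w ≤ z} = ((radialMeasure N).prod H) {p | ¬ p.1 • p.2 ≤ z} := by
  have := h.isProbabilityMeasure
  have h0 : (0 : Fin N → ℝ≥0) ∉ {w : Fin N → ℝ≥0 | ¬ w ≤ z} := by
    simp
  rw [h.polar_eq _ (measurableSet_not_le z) h0, prod_polar_image h.simplex h0]
  rfl

/-! ### Distribution function of `Z(x)` -/

section SpectralRepresentation

variable {X : Type*} [TopologicalSpace X] [MeasurableSpace C(X, ℝ≥0)] [BorelSpace C(X, ℝ≥0)]
  {Ω : Type*} [MeasurableSpace Ω] {P : Measure Ω} {ν : Measure C(X, ℝ≥0)} {x : Fin N → X}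
  {ζ : ℕ → Ω → ℝ≥0} {ψ : ℕ → Ω → C(X, ℝ≥0)} {H : Measure (Fin N → ℝ≥0)}

lemma measurable_smul_restr (x : Fin N → X) :
    Measurable fun p : ℝ≥0 × C(X, ℝ≥0) => p.1 • restr x p.2 :=
  measurable_fst.smul ((measurable_restr x).comp measurable_snd)

lemma exponentMeasure_apply {F : Set (Fin N → ℝ≥0)} (hF : MeasurableSet F) :
    ((radialMeasure 1).prod ν) ((fun p => p.1 • restr x p.2) ⁻¹' F) = exponentMeasure ν x F :=
  (Measure.map_apply (measurable_smul_restr x) hF).symm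

lemma ae_isGreatest_maxProcess (hH : IsSpectralMeasure (exponentMeasure ν x) H)
    (hp : IsPoissonProcess (fun i ω => (ζ i ω, ψ i ω)) ((radialMeasure 1).prod ν) P) :
    ∀ᵐ ω ∂P, ∀ j, IsGreatest (Set.range fun i => ζ i ω * ψ i ω (x j))
      (maxProcess ζ ψ (x j) ω) := by
  have hfin : ∀ (j : Fin N) (n : ℕ), ∀ᵐ ω ∂P,
      {i | 1 / ((n : ℝ≥0) + 1) < ζ i ω * ψ i ω (x j)}.Finite := by
    intro j n
    have hF : MeasurableSet {w : Fin N → ℝ≥0 | 1 / ((n : ℝ≥0) + 1) < w j} :=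
      measurableSet_lt measurable_const (measurable_pi_apply j)
    refine hp.ae_finite (B := (fun p => p.1 • restr x p.2) ⁻¹' {w | 1 / ((n : ℝ≥0) + 1) < w j})
      (measurable_smul_restr x hF) ?_
    rw [exponentMeasure_apply hF]
    refine (hH.measure_lt_top hF (t := 1 / ((n : ℝ≥0) + 1)) (by positivity) fun z hz => ?_).ne
    exact lt_of_lt_of_le hz
      (Finset.single_le_sum (f := z) (fun _ _ => zero_le) (Finset.mem_univ j))
  filter_upwards [ae_all_iff.2 fun j => ae_all_iff.2 (hfin j)] with ω hω j
  exact isGreatest_iSup_of_finite (hω j)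

lemma measure_maxProcess_le (hH : IsSpectralMeasure (exponentMeasure ν x) H)
    (hp : IsPoissonProcess (fun i ω => (ζ i ω, ψ i ω)) ((radialMeasure 1).prod ν) P)
    {z : Fin N → ℝ≥0} (hz : ∀ j, z j ≠ 0) :
    P {ω | (fun j => maxProcess ζ ψ (x j) ω) ≤ z} =
      ENNReal.ofReal (Real.exp (-(exponentMeasure ν x {w | ¬ w ≤ z}).toReal)) := by
  obtain ⟨t, ht, htz⟩ := exists_pos_le z hz
  have hF := measurableSet_not_le z
  have hfin : exponentMeasure ν x {w | ¬ w ≤ z} ≠ ∞ :=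
    (hH.measure_lt_top hF ht fun w hw => lt_l1Norm_of_not_le htz hw).ne
  rw [← exponentMeasure_apply hF] at hfin ⊢
  rw [← hp.measure_forall_notMem (measurable_smul_restr x hF) hfin]
  refine measure_congr ?_
  -- Attainment is essential: an unbounded supremum in `ℝ≥0` is 0 by convention and would not bound
  -- its terms.
  filter_upwards [ae_isGreatest_maxProcess hH hp] with ω hω
  refine propext ⟨fun h i => not_not.2 fun j => ?_, fun h j => ?_⟩
  · exact ((hω j).2 (Set.mem_range_self i)).trans (h j)
  · obtain ⟨i, hi⟩ := (hω j).1
    refine hi.symm.le.trans ?_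
    exact not_not.1 (h i) j

end SpectralRepresentation

/-! ### Distribution function of the maximum of `R_i Q_i` -/

section Mixture

variable {Ω : Type*} [MeasurableSpace Ω] {P : Measure Ω} {H : Measure (Fin N → ℝ≥0)}
  {c : ℝ≥0} {R : ℕ → Ω → ℝ≥0} {Q : ℕ → Ω → Fin N → ℝ≥0}

lemma ae_isGreatest_radial (hR : IsPoissonProcess R (radialMeasure c) P)
    (hQ : ∀ i, ∀ᵐ ω ∂P, Q i ω ∈ stdSimplex ℝ≥0 (Fin N)) :
    ∀ᵐ ω ∂P, ∀ j, IsGreatest (Set.range fun i => R i ω * Q i ω j) (⨆ i, R i ω * Q i ω j) := by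
  have hfin : ∀ n : ℕ, ∀ᵐ ω ∂P, {i | R i ω ∈ Set.Ioi (1 / ((n : ℝ≥0) + 1))}.Finite := by
    intro n
    refine hR.ae_finite measurableSet_Ioi ?_
    have ht : 1 / ((n : ℝ≥0) + 1) ≠ 0 := by positivity
    rw [radialMeasure_Ioi _ ht]
    exact ENNReal.mul_ne_top (by simp) (ENNReal.inv_ne_top.2 (by exact_mod_cast ht))
  filter_upwards [ae_all_iff.2 hfin, ae_all_iff.2 hQ] with ω hω hq j
  refine isGreatest_iSup_of_finite fun n => (hω n).subset fun i hi => ?_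
  exact lt_of_lt_of_le hi (mul_le_of_le_one_right zero_le (le_one_of_mem_stdSimplex (hq i) j))

/-- Given the radii, the `Q i` are still i.i.d. with law `H`, so the conditional probability is an
infinite product. -/
lemma measure_forall_smul_le [IsProbabilityMeasure H] (hR : ∀ i, Measurable (R i))
    (hQ : ∀ i, Measurable (Q i)) (hQlaw : ∀ i, HasLaw (Q i) H P) (hQind : iIndepFun Q P)
    (hRQ : IndepFun (fun ω i => R i ω) (fun ω i => Q i ω) P) (z : Fin N → ℝ≥0) :
    P {ω | ∀ i, R i ω • Q i ω ≤ z} = ∫⁻ ω, ∏' i, H {q | R i ω • q ≤ z} ∂P := by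
  have := hQind.isProbabilityMeasure
  have hRm : Measurable fun ω i => R i ω := measurable_pi_lambda _ hR
  have hQm : Measurable fun ω i => Q i ω := measurable_pi_lambda _ hQ
  have := Measure.isProbabilityMeasure_map (μ := P) hRm.aemeasurable
  have hle : MeasurableSet {p : ℝ≥0 × (Fin N → ℝ≥0) | p.1 • p.2 ≤ z} :=
    (measurable_fst.smul measurable_snd) measurableSet_Iic
  have hE : MeasurableSet {p : (ℕ → ℝ≥0) × (ℕ → Fin N → ℝ≥0) | ∀ i, p.1 i • p.2 i ≤ z} := by
    rw [Set.ofPred_forall]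
    refine MeasurableSet.iInter fun i => ?_
    have hi : Measurable fun p : (ℕ → ℝ≥0) × (ℕ → Fin N → ℝ≥0) => (p.1 i, p.2 i) :=
      ((measurable_pi_apply i).comp measurable_fst).prodMk
        ((measurable_pi_apply i).comp measurable_snd)
    exact hi hle
  have hlaw : P.map (fun ω i => Q i ω) = Measure.infinitePi fun _ => H := by
    rw [hQind.map_fun_eq_infinitePi_map hQ]
    exact congrArg _ (funext fun i => (hQlaw i).map_eq)
  have hjoint := (indepFun_iff_map_prod_eq_prod_map_map hRm.aemeasurable hQm.aemeasurable).1 hRQ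
  have hpre : {ω | ∀ i, R i ω • Q i ω ≤ z} = (fun ω => ((fun i => R i ω), fun i => Q i ω)) ⁻¹'
      {p : (ℕ → ℝ≥0) × (ℕ → Fin N → ℝ≥0) | ∀ i, p.1 i • p.2 i ≤ z} := rfl
  rw [hpre, ← Measure.map_apply (hRm.prodMk hQm) hE, hjoint, hlaw, Measure.prod_apply hE,
    lintegral_map (measurable_measure_prodMk_left hE) hRm]
  refine lintegral_congr fun ω => ?_
  have hpi : Prod.mk (fun i => R i ω) ⁻¹'
      {p : (ℕ → ℝ≥0) × (ℕ → Fin N → ℝ≥0) | ∀ i, p.1 i • p.2 i ≤ z} =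
      Set.univ.pi fun i => {q | R i ω • q ≤ z} := by
    ext q
    simp
  rw [hpi, Measure.infinitePi_pi_univ]
  exact fun i => (measurable_id.const_smul (R i ω)) measurableSet_Iic

lemma measure_iSup_radial_le [IsProbabilityMeasure H] (hH : H (stdSimplex ℝ≥0 (Fin N))ᶜ = 0)
    (hR : IsPoissonProcess R (radialMeasure c) P)
    (hQ : ∀ i, Measurable (Q i)) (hQlaw : ∀ i, HasLaw (Q i) H P) (hQind : iIndepFun Q P)
    (hQs : ∀ i, ∀ᵐ ω ∂P, Q i ω ∈ stdSimplex ℝ≥0 (Fin N))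
    (hRQ : IndepFun (fun ω i => R i ω) (fun ω i => Q i ω) P)
    {z : Fin N → ℝ≥0} (hz : ∀ j, z j ≠ 0) :
    P {ω | (fun j => ⨆ i, R i ω * Q i ω j) ≤ z} =
      ENNReal.ofReal (Real.exp
        (-(((radialMeasure c).prod H) {p | ¬ p.1 • p.2 ≤ z}).toReal)) := by
  have := hQind.isProbabilityMeasure
  have hsup : P {ω | (fun j => ⨆ i, R i ω * Q i ω j) ≤ z} = P {ω | ∀ i, R i ω • Q i ω ≤ z} := by
    refine measure_congr ?_
    filter_upwards [ae_isGreatest_radial hR hQs] with ω hω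
    refine propext ⟨fun h i j => ?_, fun h j => ?_⟩
    · exact ((hω j).2 (Set.mem_range_self i)).trans (h j)
    · obtain ⟨i, hi⟩ := (hω j).1
      exact hi.symm.le.trans (h i j)
  have hle : MeasurableSet {p : ℝ≥0 × (Fin N → ℝ≥0) | p.1 • p.2 ≤ z} :=
    (measurable_fst.smul measurable_snd) measurableSet_Iic
  set g : ℝ≥0 → ℝ≥0 := fun r => (H {q | r • q ≤ z}).toNNReal with hg
  have hgc : ∀ r, (g r : ℝ≥0∞) = H {q | r • q ≤ z} := fun r =>
    ENNReal.coe_toNNReal (measure_ne_top _ _)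
  have hgm : Measurable g := (measurable_measure_prodMk_left hle).ennreal_toNNReal
  have hg1 : ∀ r, g r ≤ 1 := fun r => by
    have : (g r : ℝ≥0∞) ≤ 1 := (hgc r).trans_le prob_le_one
    exact_mod_cast this
  have hcompl : ∀ r, 1 - (g r : ℝ≥0∞) = H {q | ¬ r • q ≤ z} := fun r => by
    have hr : MeasurableSet {q : Fin N → ℝ≥0 | r • q ≤ z} :=
      (measurable_id.const_smul r) measurableSet_Iic
    rw [hgc, ← prob_compl_eq_one_sub hr]
    rfl
  obtain ⟨t, ht, htz⟩ := exists_pos_le z hz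
  -- Vectors `r • q` with `q` in the simplex have norm `r`, so radii up to `t`, a lower bound for
  -- the coordinates of `z`, never violate the constraint.
  have hnull : ∀ r ∉ Set.Ioi t, H {q | ¬ r • q ≤ z} = 0 := by
    intro r hr
    refine measure_mono_null (fun q hq => Set.mem_compl fun hqs => hr ?_) hH
    have := lt_l1Norm_of_not_le htz hq
    rwa [l1Norm_smul, mem_stdSimplex_iff.1 hqs, mul_one] at this
  have hgB : ∀ r ∉ Set.Ioi t, g r = 1 := by
    intro r hr
    refine le_antisymm (hg1 r) ?_
    have := (hcompl r).trans (hnull r hr)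
    exact_mod_cast tsub_eq_zero_iff_le.1 this
  have hfin : radialMeasure c (Set.Ioi t) ≠ ∞ := by
    rw [radialMeasure_Ioi _ ht]
    exact ENNReal.mul_ne_top (by simp) (ENNReal.inv_ne_top.2 (by exact_mod_cast ht))
  rw [hsup, measure_forall_smul_le hR.measurable hQ hQlaw hQind hRQ z]
  simp only [← hgc]
  rw [hR.lintegral_tprod hgm hg1 measurableSet_Ioi hfin hgB,
    Measure.prod_apply (measurableSet_smul_not_le z)]
  congr 4
  simp only [hcompl]
  refine setLIntegral_eq_of_support_subset fun r hr => ?_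
  by_contra h
  exact hr (hnull r h)

end Mixture

end Representation

end MaxStable

theorem theorem1
    {X : Type*} [TopologicalSpace X] [LocallyCompactSpace X] [SecondCountableTopology X]
    [MeasurableSpace C(X, ℝ≥0)] [BorelSpace C(X, ℝ≥0)]
    (ν : Measure C(X, ℝ≥0)) [SFinite ν]
    (hν : ∀ y : X, ∫⁻ f, (f y : ℝ≥0∞) ∂ν = 1)
    (N : ℕ) (hN : 1 ≤ N) (x : Fin N → X) :
    -- the spectral measure of `Z(x)` exists and is unique
    (∃! H, MaxStable.IsSpectralMeasure (MaxStable.exponentMeasure ν x) H) ∧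
    ∀ H, MaxStable.IsSpectralMeasure (MaxStable.exponentMeasure ν x) H →
    ∀ {Ω : Type*} [MeasurableSpace Ω] (P : Measure Ω) [IsProbabilityMeasure P]
      (T : ℕ → Ω → Fin N) (Y : Fin N → ℕ → Ω → C(X, ℝ≥0)),
      (∀ i, Measurable (T i)) → (∀ k i, Measurable (Y k i)) →
      (∀ i, HasLaw (T i) (uniformOn Set.univ) P) →
      (∀ k i, HasLaw (Y k i) (MaxStable.extremalLaw ν (x k)) P) →
      (∀ i, IndepFun (T i) (fun ω k => Y k i ω) P) →
      iIndepFun (fun i ω => (T i ω, fun k => Y k i ω)) P →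
      let Q : ℕ → Ω → Fin N → ℝ≥0 := fun i ω =>
        (MaxStable.l1Norm (MaxStable.restr x (Y (T i ω) i ω)))⁻¹ •
          MaxStable.restr x (Y (T i ω) i ω)
      -- the `Q i` are independent, simplex-valued, with law `H`
      ((∀ i, ∀ᵐ ω ∂P, Q i ω ∈ stdSimplex ℝ≥0 (Fin N)) ∧
        iIndepFun Q P ∧ ∀ i, HasLaw (Q i) H P) ∧
      -- representation of `Z(x)`
      ∀ (R : ℕ → Ω → ℝ≥0),
        MaxStable.IsPoissonProcess R (MaxStable.radialMeasure N) P →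
        IndepFun (fun ω i => R i ω) (fun ω i => (T i ω, fun k => Y k i ω)) P →
      ∀ {Ω' : Type*} [MeasurableSpace Ω'] (P' : Measure Ω') [IsProbabilityMeasure P']
        (ζ : ℕ → Ω' → ℝ≥0) (ψ : ℕ → Ω' → C(X, ℝ≥0)),
        MaxStable.IsPoissonProcess (fun i ω => (ζ i ω, ψ i ω))
          ((MaxStable.radialMeasure 1).prod ν) P' →
        -- all maxima are attained almost surely
        (∀ᵐ ω ∂P', ∀ j, IsGreatest (Set.range fun i => ζ i ω * ψ i ω (x j))
          (MaxStable.maxProcess ζ ψ (x j) ω)) ∧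
        (∀ᵐ ω ∂P, ∀ j, IsGreatest (Set.range fun i => R i ω * Q i ω j)
          (⨆ i, R i ω * Q i ω j)) ∧
        -- equality in law of the two random vectors
        IdentDistrib (fun ω j => MaxStable.maxProcess ζ ψ (x j) ω)
          (fun ω j => ⨆ i, R i ω * Q i ω j) P' P := by
  refine ⟨MaxStable.existsUnique_isSpectralMeasure ν hν hN x, ?_⟩
  intro H hH Ω _ P _ T Y hT hY hTlaw hYlaw hTY hind Q
  have := hH.isProbabilityMeasure
  have hHν : H = MaxStable.spectralMeasure ν x :=
    hH.unique hN (MaxStable.isSpectralMeasure_spectralMeasure ν hν hN x)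
  have hQ : ∀ i, Measurable (Q i) := fun i =>
    MaxStable.measurable_direction.comp ((MaxStable.measurable_restr x).comp
      (MaxStable.measurable_select_comp (hT i) fun k => hY k i))
  have hQlaw : ∀ i, HasLaw (Q i) H P := fun i =>
    ⟨(hQ i).aemeasurable, hHν ▸ MaxStable.map_select_direction ν x (hT i) (fun k => hY k i)
      (hTlaw i) (fun k => hYlaw k i) (hTY i)⟩
  have hQs : ∀ i, ∀ᵐ ω ∂P, Q i ω ∈ stdSimplex ℝ≥0 (Fin N) := fun i =>
    ((hQlaw i).ae_iff MaxStable.measurableSet_stdSimplex.mem).2 hH.simplex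
  have hselect : Measurable fun p : Fin N × (Fin N → C(X, ℝ≥0)) =>
      MaxStable.direction (MaxStable.restr x (p.2 p.1)) :=
    MaxStable.measurable_direction.comp
      ((MaxStable.measurable_restr x).comp MaxStable.measurable_select)
  have hQind : iIndepFun Q P := hind.comp (fun _ p =>
    MaxStable.direction (MaxStable.restr x (p.2 p.1))) fun _ => hselect
  refine ⟨⟨hQs, hQind, hQlaw⟩, ?_⟩
  intro R hR hRTY Ω' _ P' _ ζ ψ hp
  -- The sequence `Q` is a measurable function of the sequence of pairs `(T, Y)`, so it inherits
  -- independence from `R`.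
  have hRQ : IndepFun (fun ω i => R i ω) (fun ω i => Q i ω) P :=
    hRTY.comp (ψ := fun (q : ℕ → Fin N × (Fin N → C(X, ℝ≥0))) i =>
      MaxStable.direction (MaxStable.restr x ((q i).2 (q i).1))) measurable_id
      (measurable_pi_lambda _ fun i => hselect.comp (measurable_pi_apply i))
  refine ⟨MaxStable.ae_isGreatest_maxProcess hH hp, MaxStable.ae_isGreatest_radial hR hQs, ?_⟩
  have hZ : Measurable fun ω j => MaxStable.maxProcess ζ ψ (x j) ω :=
    measurable_pi_lambda _ fun j => Measurable.iSup fun i =>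
      (hp.measurable i).fst.mul ((MaxStable.measurable_eval (x j)).comp (hp.measurable i).snd)
  have hM : Measurable fun ω j => ⨆ i, R i ω * Q i ω j :=
    measurable_pi_lambda _ fun j => Measurable.iSup fun i =>
      (hR.measurable i).mul ((measurable_pi_apply j).comp (hQ i))
  refine ⟨hZ.aemeasurable, hM.aemeasurable, ?_⟩
  have := Measure.isProbabilityMeasure_map (μ := P') hZ.aemeasurable
  have := Measure.isProbabilityMeasure_map (μ := P) hM.aemeasurable
  refine MaxStable.ext_of_Iic_ne_zero fun z hz => ?_
  rw [Measure.map_apply hZ measurableSet_Iic, Measure.map_apply hM measurableSet_Iic]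
  refine (MaxStable.measure_maxProcess_le hH hp hz).trans ?_
  rw [hH.measure_not_le z]
  exact (MaxStable.measure_iSup_radial_le hH.simplex hR hQ hQlaw hQind hQs hRQ hz).symm
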